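/- **Theorem 1.3 (Degeneracy).** All graphs are finite and simple. A graph $G$ is *$d$-degenerate* if its vertices can be ordered so that each vertex has at most $d$ neighbors among the preceding vertices; the *degeneracy* of $G$ is the smallest $d\in\mathbb N$ such that $G$ is $d$-degenerate. For $k\in\mathbb N$, the *random $k$-fold cover* of $G$ is the random graph $H$ on the vertex set $V(G)\times\{1,\dots,k\}$ obtained as follows: fix a linear order on $V(G)$, choose independently for each edge $e$ of $G$ a uniformly random permutation $\sigma_e$ of $\{1,\dots,k\}$, and for each edge $e=uv$ with $u<v$ join $(u,i)$ to $(v,\sigma_e(i))$ for all $i$ (there are no other edges). The list of $v$ is $L(v)=\{(v,i):1\le i\le k\}$. The graph $G$ is *colorable from the cover* if there is a set containing exactly one vertex from each list $L(v)$, $v\in V(G)$, that is independent in $H$; and $G$ is *$k$-DP-colorable with probability $p$* if $p$ is the probability that $G$ is colorable from its random $k$-fold cover. For every $\varepsilon\in(0,1/2)$ there is $n_0\in\mathbb N$ such that the following holds. Let $G$ be a graph with $n\ge n_0$ vertices and degeneracy $d$ such that $d\ge(\ln n)^{2/\varepsilon}$, and let $k\in\mathbb N$ satisfy $k\ge(1+\varepsilon)\,d/\ln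 d$. Then $G$ is $k$-DP-colorable with probability at least $1-\varepsilon$. -/

import Mathlib

namespace DPColoring

/-- `G` is `d`-degenerate: some ordering of the vertices gives every vertex at most `d` neighbors
among the preceding vertices. -/
def IsDegenerate {V : Type*} [Fintype V] (G : SimpleGraph V) (d : ℕ) : Prop :=
  ∃ e : V ≃ Fin (Fintype.card V), ∀ v : V, {u : V | G.Adj v u ∧ e u < e v}.ncard ≤ d

/-- The degeneracy of `G`: the smallest `d` such that `G` is `d`-degenerate. -/
noncomputable def degeneracy {V : Type*} [Fintype V] (G : SimpleGraph V) : ℕ :=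
  sInf {d : ℕ | IsDegenerate G d}

/-- The infimum defining the degeneracy is attained. -/
theorem isDegenerate_degeneracy {V : Type*} [Fintype V] (G : SimpleGraph V) :
    IsDegenerate G (degeneracy G) := by
  refine Nat.sInf_mem (s := {d : ℕ | IsDegenerate G d})
    ⟨Fintype.card V, Fintype.equivFin V, fun v => ?_⟩
  exact (Set.ncard_le_card _).trans_eq Nat.card_eq_fintype_card

/-- A DP-cover `(L, H)` of `G`, where `H` is a graph with vertex set `W`. -/
structure DPCover {V : Type*} (G : SimpleGraph V) (W : Type*) where
  /-- The list of each vertex of `G`. -/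
  L : V → Set W
  /-- The cover graph. -/
  H : SimpleGraph W
  /-- Distinct vertices have disjoint lists. -/
  disjoint : ∀ u v : V, u ≠ v → Disjoint (L u) (L v)
  /-- The lists cover the vertex set of `H`. -/
  cover : ∀ x : W, ∃ v : V, x ∈ L v
  /-- Every list is an independent set of `H`. -/
  indep : ∀ v : V, H.IsIndepSet (L v)
  /-- The edges between the lists of two adjacent vertices form a matching: no vertex of one list
  has two neighbors in the other (both sides are covered, since `u` and `v` can be exchanged). -/
  matching : ∀ u v : V, G.Adj u v → ∀ x ∈ L u, ∀ y ∈ L v, ∀ z ∈ L v,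
    H.Adj x y → H.Adj x z → y = z
  /-- Every edge of `H` joins the lists of two adjacent vertices of `G`. -/
  edges : ∀ x y : W, H.Adj x y → ∃ u v : V, G.Adj u v ∧ x ∈ L u ∧ y ∈ L v

/-- A transversal contains exactly one vertex from each list. -/
def DPCover.IsTransversal {V W : Type*} {G : SimpleGraph V} (C : DPCover G W) (T : Set W) : Prop :=
  ∀ v : V, ∃! x : W, x ∈ C.L v ∧ x ∈ T

/-- `G` is `C`-colorable: the cover `C` has an independent transversal. -/
def DPCover.IsColorable {V W : Type*} {G : SimpleGraph V} (C : DPCover G W) : Prop :=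
  ∃ T : Set W, C.IsTransversal T ∧ C.H.IsIndepSet T

/-- The graph `H_σ` on `V × [k]` given by one permutation `σ e` of `[k]` for each edge `e` of `G`:
for an edge `e = uv` with `u < v`, the vertex `(u, i)` is joined to `(v, σ e i)`. -/
def liftGraph {V : Type*} [LinearOrder V] (G : SimpleGraph V) (k : ℕ)
    (σ : G.edgeSet → Equiv.Perm (Fin k)) : SimpleGraph (V × Fin k) where
  Adj x y := ∃ h : G.Adj x.1 y.1,
    (x.1 < y.1 ∧ σ ⟨s(x.1, y.1), h⟩ x.2 = y.2) ∨ (y.1 < x.1 ∧ σ ⟨s(x.1, y.1), h⟩ y.2 = x.2)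
  symm := ⟨by
    rintro ⟨u, i⟩ ⟨v, j⟩ ⟨h, h'⟩
    have e : (⟨s(v, u), h.symm⟩ : G.edgeSet) = ⟨s(u, v), h⟩ := Subtype.ext Sym2.eq_swap
    refine ⟨h.symm, ?_⟩
    dsimp only at h' ⊢
    rw [e]
    exact h'.symm⟩
  loopless := ⟨fun _ ⟨h, _⟩ => h.ne rfl⟩

/-- The full `k`-fold cover `(L, H_σ)` of `G`, with `L(v) = {(v, i) : i ∈ [k]}`. -/
def liftCover {V : Type*} [LinearOrder V] (G : SimpleGraph V) (k : ℕ)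
    (σ : G.edgeSet → Equiv.Perm (Fin k)) : DPCover G (V × Fin k) where
  L v := {x | x.1 = v}
  H := liftGraph G k σ
  disjoint u v huv := Set.disjoint_left.mpr fun _ hu hv => huv (hu.symm.trans hv)
  cover x := ⟨x.1, rfl⟩
  indep v := by
    rintro x hx y hy - ⟨h, -⟩
    exact h.ne (hx.trans hy.symm)
  matching := by
    rintro u v - ⟨a, i⟩ rfl ⟨b, j⟩ rfl ⟨c, l⟩ hc ⟨_, h1⟩ ⟨_, h2⟩
    obtain rfl : c = b := hc
    dsimp only at h1 h2
    rcases h1 with ⟨o1, h1⟩ | ⟨o1, h1⟩ <;> rcases h2 with ⟨o2, h2⟩ | ⟨o2, h2⟩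
    · rw [← h1, ← h2]
    · exact absurd o2 o1.asymm
    · exact absurd o2 o1.asymm
    · rw [Equiv.injective _ (h1.trans h2.symm)]
  edges := by
    rintro x y ⟨h, -⟩
    exact ⟨x.1, y.1, h, rfl, rfl⟩

/-- Distinct families of permutations give distinct covers, so that a uniformly random family
gives a uniformly random element of the set of all covers `(L, H_σ)`. -/
theorem liftCover_injective {V : Type*} [LinearOrder V] (G : SimpleGraph V) (k : ℕ) :
    Function.Injective (liftCover G k) := by
  intro σ τ hst
  have hH : liftGraph G k σ = liftGraph G k τ := congrArg DPCover.H hst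
  have key : ∀ u v : V, u < v → ∀ h : G.Adj u v, σ ⟨s(u, v), h⟩ = τ ⟨s(u, v), h⟩ := by
    intro u v huv h
    ext1 i
    have h1 : (liftGraph G k σ).Adj (u, i) (v, σ ⟨s(u, v), h⟩ i) := ⟨h, Or.inl ⟨huv, rfl⟩⟩
    rw [hH] at h1
    obtain ⟨_, ⟨_, h2⟩ | ⟨h2, _⟩⟩ := h1
    · exact h2.symm
    · exact absurd huv h2.asymm
  funext ⟨e, he⟩
  induction e using Sym2.ind with
  | _ u v =>
    have huv : G.Adj u v := he
    rcases huv.ne.lt_or_gt with h | h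
    · exact key u v h huv
    · have hs : (⟨s(u, v), he⟩ : G.edgeSet) = ⟨s(v, u), huv.symm⟩ := Subtype.ext Sym2.eq_swap
      rw [hs]
      exact key v u h huv.symm

open Classical in
/-- The law of the random `k`-fold cover of `G`: the permutations attached to the edges of `G` are
independent and uniformly random, i.e. the family `σ` is uniform among the `(k!) ^ |E(G)|` ones. -/
noncomputable def randomCover {V : Type*} [Fintype V] [LinearOrder V] (G : SimpleGraph V) (k : ℕ) :
    PMF (DPCover G (V × Fin k)) :=
  (PMF.uniformOfFintype (G.edgeSet → Equiv.Perm (Fin k))).map (liftCover G k)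

/-- The probability that `G` is colorable from its random `k`-fold cover. -/
noncomputable def probDPColorable {V : Type*} [Fintype V] [LinearOrder V] (G : SimpleGraph V)
    (k : ℕ) : ℝ :=
  ((randomCover G k).toOuterMeasure {C | C.IsColorable}).toReal

end DPColoring

open Finset Filter

namespace DPColoring

/-! Color greedily along a degeneracy ordering. Fix the permutations off the back edges of `v`; they
alone decide which colorings of the vertices before `v` are proper, so one can be fixed too. Each of
the at most `d` back edges then independently forbids a uniform color, and `v` is stuck only if all
`k` colors are forbidden. As in balls and bins, where hitting different bins is negatively
correlated, this has probability at most `(1 - (1 - 1/k)^d)^k` (`sum_covering_le`,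
`sum_not_extendable_le`).

A union bound over the `n` vertices gives failure probability at most `n * exp (-(k * (1 -
1/k)^d))`. The bound on `k` makes the expected number `k * (1 - 1/k)^d` of free colors at least
`d^(ε/2) + log (1/ε)`, and `d^(ε/2) ≥ log n` by the bound on `d`. -/

/-! ### Averaging over fibers, and balls in bins -/

/-- If every partial assignment on the complement of `p` leaves at most a proportion `c` of the
assignments on `p` satisfying `A`, then at most a proportion `c` of all assignments satisfy `A`. -/
theorem sum_indicator_le_of_fiberwise {ι Ω : Type*} [Fintype ι] [DecidableEq ι] [Fintype Ω]
    (p : ι → Prop) [DecidablePred p] (A : (ι → Ω) → Prop) [DecidablePred A] (c : ℝ)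
    (h : ∀ ρ : {x // ¬ p x} → Ω,
      ∑ τ : {x // p x} → Ω, (if A ((Equiv.piEquivPiSubtypeProd p fun _ => Ω).symm (τ, ρ))
        then (1 : ℝ) else 0) ≤ c * Fintype.card ({x // p x} → Ω)) :
    ∑ σ : ι → Ω, (if A σ then (1 : ℝ) else 0) ≤ c * Fintype.card (ι → Ω) := by
  have key := Fintype.sum_equiv (Equiv.piEquivPiSubtypeProd p fun _ => Ω).symm
    (fun x => if A ((Equiv.piEquivPiSubtypeProd p fun _ => Ω).symm x) then (1 : ℝ) else 0)
    (fun σ => if A σ then (1 : ℝ) else 0) (fun _ => rfl)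
  rw [← key, Fintype.sum_prod_type_right]
  refine (sum_le_sum fun ρ _ => h ρ).trans_eq ?_
  rw [Fintype.card_congr (Equiv.piEquivPiSubtypeProd p fun _ => Ω), Fintype.card_prod]
  simp only [sum_const, card_univ, nsmul_eq_mul, Nat.cast_mul]
  ring

/-- The first two terms of the binomial expansion. -/
theorem pow_add_mul_le_add_pow {a b : ℝ} (ha : 0 ≤ a) (hb : 0 ≤ b) (s : ℕ) :
    a ^ s + s * a ^ (s - 1) * b ≤ (a + b) ^ s := by
  induction s with
  | zero => simp
  | succ s ih =>
    have h1 : (a + b) * (a ^ s + s * a ^ (s - 1) * b) ≤ (a + b) ^ (s + 1) := by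
      rw [pow_succ']
      exact mul_le_mul_of_nonneg_left ih (by positivity)
    refine le_trans ?_ h1
    rcases s with _ | s
    · simp
    · have : 0 ≤ ((s : ℝ) + 1) * a ^ s * b ^ 2 := by positivity
      simp only [Nat.add_sub_cancel]
      push_cast
      ring_nf at this ⊢
      nlinarith

/-- Throwing `m` independent uniform balls into `k` bins, the probability that every bin of `S` is
hit is at most `(1 - (1 - 1 / k) ^ m) ^ #S`. -/
theorem sum_covering_le {k : ℕ} (hk : 0 < k) {Ω : Type*} [Fintype Ω] (m : ℕ)
    (g : Fin m → Ω → Fin k)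
    (hg : ∀ e j, (∑ ω, if g e ω = j then (1 : ℝ) else 0) = Fintype.card Ω / k)
    (S : Finset (Fin k)) :
    ∑ τ : Fin m → Ω, (if ∀ i ∈ S, ∃ e, g e (τ e) = i then (1 : ℝ) else 0)
      ≤ (1 - (1 - 1 / (k : ℝ)) ^ m) ^ #S * Fintype.card Ω ^ m := by
  have hk' : (1 : ℝ) ≤ k := by exact_mod_cast hk
  have hq0 : (0 : ℝ) ≤ 1 - 1 / k := by
    rw [sub_nonneg, div_le_one (by linarith)]; exact hk'
  have hq1 : 1 - 1 / (k : ℝ) ≤ 1 := by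
    have : (0 : ℝ) ≤ 1 / k := by positivity
    linarith
  induction m generalizing S with
  | zero =>
    rcases S.eq_empty_or_nonempty with rfl | hS
    · simp
    · obtain ⟨i, hi⟩ := hS
      have : ¬ (∀ i ∈ S, ∃ e : Fin 0, g e ((default : Fin 0 → Ω) e) = i) := fun h =>
        (h i hi).choose.elim0
      rw [Fintype.sum_unique, if_neg this]
      simp
  | succ m ih =>
    set x : ℝ := (1 - 1 / (k : ℝ)) ^ m with hx
    have hx0 : 0 ≤ x := pow_nonneg hq0 m
    have hx1 : x ≤ 1 := pow_le_one₀ hq0 hq1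
    set C : ℝ := (Fintype.card Ω : ℝ)
    -- Expose ball `0`: the remaining `m` balls must hit the bins of `S` other than the one it hit.
    have split : ∑ τ : Fin (m + 1) → Ω, (if ∀ i ∈ S, ∃ e, g e (τ e) = i then (1 : ℝ) else 0)
        = ∑ ω : Ω, ∑ τ : Fin m → Ω,
          (if ∀ i ∈ S.erase (g 0 ω), ∃ e : Fin m, g e.succ (τ e) = i then (1 : ℝ) else 0) := by
      rw [← Fintype.sum_prod_type', ← Fintype.sum_equiv (Fin.consEquiv fun _ => Ω) _ _ fun _ => rfl]
      refine sum_congr rfl fun y _ => if_congr ?_ rfl rfl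
      simp only [Fin.exists_fin_succ, Fin.consEquiv, Equiv.coe_fn_mk, Fin.cons_zero, Fin.cons_succ,
        mem_erase]
      exact forall_congr' fun i => ⟨fun h hi => (h hi.2).resolve_left fun e => hi.1 e.symm,
        fun h hi => or_iff_not_imp_left.2 fun hne => h ⟨fun e => hne e.symm, hi⟩⟩
    have weight : ∀ F : Fin k → ℝ, ∑ ω : Ω, F (g 0 ω) = C / k * ∑ j, F j := by
      intro F
      calc ∑ ω : Ω, F (g 0 ω) = ∑ ω : Ω, ∑ j, (if g 0 ω = j then (1 : ℝ) else 0) * F j := by simp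
        _ = ∑ j, (∑ ω, if g 0 ω = j then (1 : ℝ) else 0) * F j := by
          rw [sum_comm]; simp only [sum_mul]
        _ = _ := by simp only [hg, mul_sum]
    have count : ∑ j, (1 - x) ^ #(S.erase j)
        = #S * (1 - x) ^ (#S - 1) + (k - #S) * (1 - x) ^ #S := by
      rw [← sum_add_sum_compl S]
      congr 1
      · rw [sum_congr rfl fun j hj => by rw [card_erase_of_mem hj]]
        simp
      · rw [sum_congr rfl fun j hj => by rw [erase_eq_of_notMem (mem_compl.1 hj)]]
        rw [sum_const, nsmul_eq_mul, card_compl, Fintype.card_fin,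
          Nat.cast_sub (by simpa using card_le_univ S)]
    rw [split]
    calc _ ≤ ∑ ω : Ω, (1 - x) ^ #(S.erase (g 0 ω)) * C ^ m :=
          sum_le_sum fun ω _ => ih (fun e => g e.succ) (fun e j => hg e.succ j) _
      _ = C ^ (m + 1) * ((#S * (1 - x) ^ (#S - 1) + (k - #S) * (1 - x) ^ #S) / k) := by
          rw [weight fun j => (1 - x) ^ #(S.erase j) * C ^ m, ← sum_mul, count]
          ring
      -- The averaged bound equals `(1 - x)^s + s * (1 - x)^(s - 1) * (x / k)` with `s = #S`: the
      -- first two terms of a binomial expansion.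
      _ ≤ C ^ (m + 1) * (1 - x + x / k) ^ #S := by
          refine mul_le_mul_of_nonneg_left ?_ (by positivity)
          refine le_trans (le_of_eq ?_)
            (pow_add_mul_le_add_pow (sub_nonneg.2 hx1) (by positivity : 0 ≤ x / k) #S)
          rcases h : #S with _ | s
          · simp [hk.ne']
          · simp only [Nat.add_sub_cancel, pow_succ]
            field_simp
            ring
      _ = _ := by
          rw [mul_comm, pow_succ (1 - 1 / (k : ℝ)), ← hx]
          congr 2
          ring

/-- Having fewer than `d` balls only lowers the covering probability, so `d` may replace the exact
number of back edges. -/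
theorem sum_covering_univ_le {k : ℕ} (hk : 0 < k) {ι Ω : Type*} [Fintype ι] [DecidableEq ι]
    [Fintype Ω] (g : ι → Ω → Fin k)
    (hg : ∀ e j, (∑ ω, if g e ω = j then (1 : ℝ) else 0) = Fintype.card Ω / k)
    {d : ℕ} (hd : Fintype.card ι ≤ d) :
    ∑ τ : ι → Ω, (if ∀ i, ∃ e, g e (τ e) = i then (1 : ℝ) else 0)
      ≤ (1 - (1 - 1 / (k : ℝ)) ^ d) ^ k * Fintype.card (ι → Ω) := by
  let φ := Fintype.equivFin ι
  have h := sum_covering_le hk (Fintype.card ι) (fun e => g (φ.symm e)) (fun e => hg _) univ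
  have hk' : (1 : ℝ) ≤ k := by exact_mod_cast hk
  have hq0 : (0 : ℝ) ≤ 1 - 1 / k := by
    rw [sub_nonneg, div_le_one (by linarith)]; exact hk'
  have hq1 : 1 - 1 / (k : ℝ) ≤ 1 := by
    have : (0 : ℝ) ≤ 1 / k := by positivity
    linarith
  rw [← Fintype.sum_equiv (φ.symm.arrowCongr (Equiv.refl Ω))
    (fun τ : Fin (Fintype.card ι) → Ω =>
      if ∀ i ∈ (univ : Finset (Fin k)), ∃ e, g (φ.symm e) (τ e) = i then (1 : ℝ) else 0)]
  · refine h.trans ?_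
    rw [Fintype.card_fun, card_univ, Fintype.card_fin]
    push_cast
    refine mul_le_mul_of_nonneg_right ?_ (by positivity)
    refine pow_le_pow_left₀ (sub_nonneg.2 (pow_le_one₀ hq0 hq1)) ?_ k
    exact sub_le_sub_left (pow_le_pow_of_le_one hq0 hq1 hd) 1
  · intro τ
    refine if_congr ?_ rfl rfl
    simp only [mem_univ, forall_const]
    refine forall_congr' fun i => ?_
    rw [← φ.symm.exists_congr_right]
    simp [Equiv.arrowCongr]

/-! ### Uniformity of the forbidden color -/

theorem sum_perm_apply_eq {k : ℕ} (hk : 0 < k) (a b : Fin k) :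
    (∑ π : Equiv.Perm (Fin k), if π a = b then (1 : ℝ) else 0)
      = Fintype.card (Equiv.Perm (Fin k)) / k := by
  have hk' : (0 : ℝ) < k := by exact_mod_cast hk
  have h : ∀ c, (∑ π : Equiv.Perm (Fin k), if π a = c then (1 : ℝ) else 0)
      = ∑ π : Equiv.Perm (Fin k), if π a = b then (1 : ℝ) else 0 := fun c =>
    -- Composing with the transposition of `b` and `c` exchanges the events `π a = c` and `π a = b`.
    Fintype.sum_equiv (Equiv.mulLeft (Equiv.swap b c)) _ _ fun π => if_congr
      (by rw [Equiv.coe_mulLeft, Equiv.Perm.mul_apply, Equiv.swap_apply_eq_iff,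
        Equiv.swap_apply_left]) rfl rfl
  have total : ∑ c, (∑ π : Equiv.Perm (Fin k), if π a = c then (1 : ℝ) else 0)
      = Fintype.card (Equiv.Perm (Fin k)) := by
    rw [sum_comm]; simp
  rw [sum_congr rfl fun c _ => h c, sum_const, card_univ, Fintype.card_fin, nsmul_eq_mul] at total
  rw [← total]
  field_simp

theorem sum_perm_symm_apply_eq {k : ℕ} (hk : 0 < k) (a b : Fin k) :
    (∑ π : Equiv.Perm (Fin k), if π.symm a = b then (1 : ℝ) else 0)
      = Fintype.card (Equiv.Perm (Fin k)) / k := by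
  rw [← sum_perm_apply_eq hk b a]
  exact sum_congr rfl fun π _ => if_congr (by rw [Equiv.symm_apply_eq, eq_comm]) rfl rfl

/-- The color of `v` forbidden by the color `a` of its neighbor `u` when the edge between them
carries the permutation `π`. -/
noncomputable def forbiddenColor {V : Type*} [LinearOrder V] {k : ℕ} (v u : V) (a : Fin k) (π : Equiv.Perm (Fin k)) : Fin k :=
  if u < v then π a else π.symm a

theorem sum_forbiddenColor_eq {V : Type*} [LinearOrder V] {k : ℕ} (hk : 0 < k) (v u : V) (a b : Fin k) :
    (∑ π : Equiv.Perm (Fin k), if forbiddenColor v u a π = b then (1 : ℝ) else 0)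
      = Fintype.card (Equiv.Perm (Fin k)) / k := by
  unfold forbiddenColor
  split_ifs
  · exact sum_perm_apply_eq hk a b
  · exact sum_perm_symm_apply_eq hk a b

/-! ### Greedy coloring along an ordering -/

section Greedy

variable {V : Type*} [Fintype V] [LinearOrder V] (G : SimpleGraph V) {k : ℕ}
  (o : V ≃ Fin (Fintype.card V))

/-- `f` is a proper coloring, from the cover given by `σ`, of the first `m` vertices in the
ordering `o`. -/
def IsPartialColoring (σ : G.edgeSet → Equiv.Perm (Fin k)) (m : ℕ) (f : V → Fin k) : Prop :=
  ∀ x y : V, ∀ h : G.Adj x y, x < y → (o x : ℕ) < m → (o y : ℕ) < m →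
    σ ⟨s(x, y), h⟩ (f x) ≠ f y

/-- The first `m` vertices in the ordering `o` can be colored from the cover given by `σ`. -/
def PartiallyColorable (m : ℕ) (σ : G.edgeSet → Equiv.Perm (Fin k)) : Prop :=
  ∃ f : V → Fin k, IsPartialColoring G o σ m f

variable {G}

theorem isColorable_of_partiallyColorable {σ : G.edgeSet → Equiv.Perm (Fin k)}
    (h : PartiallyColorable G o (Fintype.card V) σ) : (liftCover G k σ).IsColorable := by
  obtain ⟨f, hf⟩ := h
  refine ⟨{x | x.2 = f x.1}, fun v => ⟨(v, f v), ⟨rfl, rfl⟩, ?_⟩, ?_⟩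
  · rintro ⟨w, i⟩ ⟨hw, hi⟩
    obtain rfl : w = v := hw
    exact Prod.ext rfl hi
  · rintro ⟨u, i⟩ hi ⟨w, j⟩ hj - ⟨hadj, hc⟩
    obtain rfl : i = f u := hi
    obtain rfl : j = f w := hj
    rcases hc with ⟨hlt, hc⟩ | ⟨hlt, hc⟩
    · exact hf u w hadj hlt (o u).2 (o w).2 hc
    · refine hf w u hadj.symm hlt (o w).2 (o u).2 ?_
      refine Eq.trans ?_ hc
      exact congrArg (fun e => σ e (f w)) (Subtype.ext Sym2.eq_swap)

/-- `e` joins `v` to a preceding vertex. -/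
def IsBackEdge (v : V) (e : G.edgeSet) : Prop :=
  ∃ u, (e : Sym2 V) = s(v, u) ∧ o u < o v

variable {o}

/-- A coloring of the vertices preceding `v` extends to `v` with any color that is not forbidden. -/
theorem IsPartialColoring.update {σ : G.edgeSet → Equiv.Perm (Fin k)} {v : V} {f : V → Fin k}
    (hf : IsPartialColoring G o σ (o v) f) {i : Fin k}
    (hi : ∀ u (h : G.Adj v u), o u < o v → forbiddenColor v u (f u) (σ ⟨s(v, u), h⟩) ≠ i) :
    IsPartialColoring G o σ (o v + 1) (Function.update f v i) := by
  intro x y h hxy hx hy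
  have lt : ∀ w : V, w ≠ v → (o w : ℕ) < o v + 1 → (o w : ℕ) < o v := fun w hw hlt =>
    lt_of_le_of_ne (Nat.lt_succ_iff.1 hlt) fun e => hw (o.injective (Fin.ext e))
  by_cases hxv : x = v
  · subst hxv
    have hyx : y ≠ x := hxy.ne'
    have := hi y h (lt y hyx hy)
    rw [forbiddenColor, if_neg hxy.asymm, ne_eq, Equiv.symm_apply_eq] at this
    rw [Function.update_self, Function.update_of_ne hyx]
    exact fun e => this e.symm
  · by_cases hyv : y = v
    · subst hyv
      have := hi x h.symm (lt x hxv hx)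
      rw [forbiddenColor, if_pos hxy] at this
      rw [Function.update_self, Function.update_of_ne hxv]
      convert this using 3
      exact Subtype.ext Sym2.eq_swap
    · rw [Function.update_of_ne hxv, Function.update_of_ne hyv]
      exact hf x y h hxy (lt x hxv hx) (lt y hyv hy)

/-- Whether `f` colors the vertices preceding `v` does not depend on the permutations at the back
edges of `v`. -/
theorem IsPartialColoring.congr {σ σ' : G.edgeSet → Equiv.Perm (Fin k)} {v : V} {f : V → Fin k}
    (hf : IsPartialColoring G o σ (o v) f) (h : ∀ e, ¬ IsBackEdge o v e → σ e = σ' e) :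
    IsPartialColoring G o σ' (o v) f := by
  intro x y hadj hxy hx hy
  rw [← h]
  · exact hf x y hadj hxy hx hy
  · rintro ⟨u, hu, -⟩
    have hv : v ∈ s(x, y) := by
      change (s(x, y) : Sym2 V) = s(v, u) at hu
      rw [hu]
      exact Sym2.mem_mk_left v u
    rcases Sym2.mem_iff.1 hv with rfl | rfl
    · exact lt_irrefl _ hx
    · exact lt_irrefl _ hy

open Classical in
theorem sum_not_extendable_le (hk : 0 < k) {d : ℕ} (v : V)
    (hd : {u : V | G.Adj v u ∧ o u < o v}.ncard ≤ d) :
    ∑ σ : G.edgeSet → Equiv.Perm (Fin k),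
      (if PartiallyColorable G o (o v) σ ∧ ¬ PartiallyColorable G o (o v + 1) σ
        then (1 : ℝ) else 0)
      ≤ (1 - (1 - 1 / (k : ℝ)) ^ d) ^ k
        * Fintype.card (G.edgeSet → Equiv.Perm (Fin k)) := by
  refine sum_indicator_le_of_fiberwise (IsBackEdge o v) _ _ fun ρ => ?_
  choose u hu using fun e : {e : G.edgeSet // IsBackEdge o v e} => e.2
  have hadj : ∀ e, G.Adj v (u e) := fun e => by
    have := e.1.2
    rwa [(hu e).1] at this
  have hcard : Fintype.card {e : G.edgeSet // IsBackEdge o v e} ≤ d := by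
    refine le_trans ?_ hd
    rw [← Nat.card_coe_set_eq, Nat.card_eq_fintype_card]
    refine Fintype.card_le_of_injective
      (fun e => (⟨u e, hadj e, (hu e).2⟩ : {u : V | G.Adj v u ∧ o u < o v})) fun e e' hee => ?_
    have h2 : u e = u e' := congrArg Subtype.val hee
    refine Subtype.ext (Subtype.ext ?_)
    rw [(hu e).1, (hu e').1, h2]
  have h1 : (1 : ℝ) ≤ k := by exact_mod_cast hk
  have hq0 : (0 : ℝ) ≤ 1 - 1 / k := by
    rw [sub_nonneg, div_le_one (by linarith)]; exact h1
  have hq1 : 1 - 1 / (k : ℝ) ≤ 1 := by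
    have : (0 : ℝ) ≤ 1 / k := by positivity
    linarith
  by_cases hex : ∃ τ, PartiallyColorable G o (o v)
      ((Equiv.piEquivPiSubtypeProd (IsBackEdge o v) fun _ => Equiv.Perm (Fin k)).symm (τ, ρ))
  -- The coloring `f` is chosen from `ρ` alone, before `τ` varies, so the forbidden colors stay
  -- independent; `IsPartialColoring.congr` carries it from `τ₀` to every `τ`.
  · obtain ⟨τ₀, f, hf⟩ := hex
    refine le_trans (sum_le_sum fun τ _ => ?_)
      (sum_covering_univ_le hk (fun e => forbiddenColor v (u e) (f (u e)))
        (fun e j => sum_forbiddenColor_eq hk v (u e) (f (u e)) j) hcard)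
    by_cases hτ : ∀ i, ∃ e, forbiddenColor v (u e) (f (u e)) (τ e) = i
    · rw [if_pos hτ]
      split_ifs <;> norm_num
    · rw [if_neg hτ, if_neg]
      rintro ⟨-, hn⟩
      push Not at hτ
      obtain ⟨i, hi⟩ := hτ
      refine hn ⟨_, (hf.congr fun e he => ?_).update (i := i) fun w hw hlt => ?_⟩
      · simp [Equiv.piEquivPiSubtypeProd, he]
      · have hb : IsBackEdge o v ⟨s(v, w), hw⟩ := ⟨w, rfl, hlt⟩
        have hw' : u ⟨_, hb⟩ = w := (Sym2.congr_right.1 (hu ⟨_, hb⟩).1).symm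
        have := hi ⟨_, hb⟩
        rw [hw'] at this
        simpa [Equiv.piEquivPiSubtypeProd, hb] using this
  · push Not at hex
    rw [sum_eq_zero fun τ _ => if_neg fun h => hex τ h.1]
    exact mul_nonneg (pow_nonneg (sub_nonneg.2 (pow_le_one₀ hq0 hq1)) _) (Nat.cast_nonneg _)

-- Union bound over the first vertex at which the colorable prefix cannot be extended.
open Classical in
theorem sum_not_partiallyColorable_le (hk : 0 < k) {d : ℕ}
    (hd : ∀ v, {u : V | G.Adj v u ∧ o u < o v}.ncard ≤ d) (m : ℕ) (hm : m ≤ Fintype.card V) :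
    ∑ σ : G.edgeSet → Equiv.Perm (Fin k),
      (if ¬ PartiallyColorable G o m σ then (1 : ℝ) else 0)
      ≤ m * ((1 - (1 - 1 / (k : ℝ)) ^ d) ^ k
        * Fintype.card (G.edgeSet → Equiv.Perm (Fin k))) := by
  induction m with
  | zero =>
    refine (sum_eq_zero fun σ _ => if_neg ?_).trans_le (by simp)
    exact not_not.2 ⟨fun _ => ⟨0, hk⟩, fun x y h hxy hx => absurd hx (Nat.not_lt_zero _)⟩
  | succ m ih =>
    have hv : (o (o.symm ⟨m, hm⟩) : ℕ) = m := by simp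
    have step := sum_not_extendable_le (o := o) hk (o.symm ⟨m, hm⟩) (hd _)
    rw [hv] at step
    push_cast
    rw [add_mul, one_mul]
    refine le_trans ?_ (add_le_add (ih (Nat.le_of_succ_le hm)) step)
    rw [← sum_add_distrib]
    refine sum_le_sum fun σ _ => ?_
    by_cases h1 : PartiallyColorable G o m σ <;> by_cases h2 : PartiallyColorable G o (m + 1) σ <;>
      simp [h1, h2]

end Greedy

/-- The coloring probability is at least `1 - n (1 - (1 - 1 / k) ^ d) ^ k`. -/
theorem one_sub_le_probDPColorable {V : Type*} [Fintype V] [LinearOrder V] (G : SimpleGraph V)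
    {k d : ℕ} (hk : 0 < k) (hG : IsDegenerate G d) :
    1 - Fintype.card V * (1 - (1 - 1 / (k : ℝ)) ^ d) ^ k ≤ probDPColorable G k := by
  classical
  obtain ⟨o, ho⟩ := hG
  have hbad := sum_not_partiallyColorable_le (o := o) hk ho _ le_rfl
  have hN : (0 : ℝ) < Fintype.card (G.edgeSet → Equiv.Perm (Fin k)) := by
    exact_mod_cast Fintype.card_pos
  have hprob : probDPColorable G k
      = (∑ σ : G.edgeSet → Equiv.Perm (Fin k),
          if (liftCover G k σ).IsColorable then (1 : ℝ) else 0)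
        / Fintype.card (G.edgeSet → Equiv.Perm (Fin k)) := by
    rw [probDPColorable, randomCover, PMF.toOuterMeasure_map_apply,
      PMF.toOuterMeasure_uniformOfFintype_apply, ENNReal.toReal_div, ENNReal.toReal_natCast,
      ENNReal.toReal_natCast, sum_boole, Fintype.card_subtype]
    congr!
  rw [hprob, le_div_iff₀ hN, sub_mul, one_mul, mul_assoc]
  have htot : (Fintype.card (G.edgeSet → Equiv.Perm (Fin k)) : ℝ)
      ≤ (∑ σ : G.edgeSet → Equiv.Perm (Fin k),
          if (liftCover G k σ).IsColorable then (1 : ℝ) else 0)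
        + ∑ σ : G.edgeSet → Equiv.Perm (Fin k),
          if ¬ PartiallyColorable G o (Fintype.card V) σ then (1 : ℝ) else 0 := by
    rw [← sum_add_distrib, ← card_univ, card_eq_sum_ones]
    push_cast
    refine sum_le_sum fun σ _ => ?_
    by_cases h : PartiallyColorable G o (Fintype.card V) σ
    · simp [h, isColorable_of_partiallyColorable o h]
    · simp only [h, not_false_eq_true, if_true]
      split_ifs <;> norm_num
  linarith

/-! ### Asymptotic estimates -/

theorem one_sub_pow_le_exp {k d : ℕ} (hk : 0 < k) :
    (1 - (1 - 1 / (k : ℝ)) ^ d) ^ k ≤ Real.exp (-(k * (1 - 1 / (k : ℝ)) ^ d)) := by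
  have h1 : (1 : ℝ) ≤ k := by exact_mod_cast hk
  have hq0 : (0 : ℝ) ≤ 1 - 1 / k := by
    rw [sub_nonneg, div_le_one (by linarith)]; exact h1
  have hq1 : 1 - 1 / (k : ℝ) ≤ 1 := by
    have : (0 : ℝ) ≤ 1 / k := by positivity
    linarith
  rw [← mul_neg, Real.exp_nat_mul]
  exact pow_le_pow_left₀ (sub_nonneg.2 (pow_le_one₀ hq0 hq1))
    (Real.one_sub_le_exp_neg _) k

/-- Since `1 - 1/k = 1 / (1 + 1/(k - 1))`, this is `1 + x ≤ exp x` at `x = 1/(k - 1)`. -/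
theorem exp_neg_div_le_one_sub_inv_pow {k : ℝ} (hk : 1 < k) (d : ℕ) :
    Real.exp (-(d / (k - 1))) ≤ (1 - 1 / k) ^ d := by
  have h : Real.exp (-(1 / (k - 1))) ≤ 1 - 1 / k := by
    have h1 := Real.add_one_le_exp (1 / (k - 1))
    have hk1 : 0 < k - 1 := by linarith
    rw [Real.exp_neg, inv_le_comm₀ (Real.exp_pos _)
      (by rw [sub_pos, div_lt_one (by linarith)]; exact hk)]
    refine le_trans (le_of_eq ?_) h1
    field_simp
    ring
  calc Real.exp (-(d / (k - 1))) = Real.exp (-(1 / (k - 1))) ^ d := by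
        rw [← Real.exp_nat_mul]; congr 1; ring
    _ ≤ _ := pow_le_pow_left₀ (Real.exp_pos _).le h d

/-- For `k ≥ (1 + ε) d / log d` and `d` large, the expected number `k (1 - 1 / k) ^ d` of colors
missed by `d` uniform choices is at least `d ^ (ε / 2) + C`. -/
theorem eventually_le_mul_one_sub_inv_pow {ε : ℝ} (hε₀ : 0 < ε) (hε₁ : ε < 1 / 2) (C : ℝ) :
    ∀ᶠ d : ℕ in atTop, ∀ k : ℕ, (1 + ε) * (d : ℝ) / Real.log d ≤ k →
      0 < k ∧ (d : ℝ) ^ (ε / 2) + C ≤ k * (1 - 1 / (k : ℝ)) ^ d := by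
  -- A slack of `ε/4` pays for replacing `k` by `k - 1`; what is left gives `(1 - 1/k)^d ≥ d^(c -
  -- 1)`. As `c > ε/2`, `d^c / log d` exceeds `2 * d^(ε/2)`, and the second copy absorbs `C`.
  set c : ℝ := 1 - 1 / (1 + 3 * ε / 4) with hc
  have hc' : 0 < c - ε / 2 := by
    have : c - ε / 2 = ε * (2 - 3 * ε) / (8 + 6 * ε) := by
      rw [hc]; field_simp; ring
    rw [this]
    exact div_pos (mul_pos hε₀ (by linarith)) (by linarith)
  have e1 : ∀ᶠ x : ℝ in atTop, C ≤ x ^ (ε / 2) :=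
    (tendsto_rpow_atTop (by linarith)).eventually_ge_atTop C
  have e2 : ∀ᶠ x : ℝ in atTop, ‖Real.log x‖ ≤ 1 / 2 * ‖x ^ (c - ε / 2)‖ :=
    (isLittleO_log_rpow_atTop hc').def (by norm_num)
  have e3 : ∀ᶠ x : ℝ in atTop, ‖Real.log x‖ ≤ ε / 4 * ‖x ^ (1 : ℝ)‖ :=
    (isLittleO_log_rpow_atTop one_pos).def (by linarith)
  have e4 : ∀ᶠ x : ℝ in atTop, 1 < x := eventually_gt_atTop 1
  filter_upwards [tendsto_natCast_atTop_atTop.eventually (e1.and (e2.and (e3.and e4)))]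
    with d ⟨h1, h2, h3, h4⟩ k hk
  have hd0 : (0 : ℝ) < d := by linarith
  have hlog : 0 < Real.log d := Real.log_pos h4
  rw [Real.norm_of_nonneg hlog.le, Real.norm_of_nonneg (by positivity)] at h2 h3
  rw [Real.rpow_one] at h3
  have hkd : (1 + 3 * ε / 4) * d / Real.log d ≤ k - 1 := by
    have : 1 ≤ ε / 4 * d / Real.log d := (one_le_div hlog).2 h3
    have e : (1 + ε) * (d : ℝ) / Real.log d
        = (1 + 3 * ε / 4) * d / Real.log d + ε / 4 * d / Real.log d := by ring
    linarith
  have hpos : 0 < (1 + 3 * ε / 4) * d / Real.log d := by positivity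
  have hk1 : (1 : ℝ) < k := by linarith
  refine ⟨by exact_mod_cast (zero_lt_one.trans hk1), ?_⟩
  have hkge : d / Real.log d ≤ (k : ℝ) := by
    have : d / Real.log d ≤ (1 + 3 * ε / 4) * d / Real.log d := by
      gcongr
      nlinarith
    linarith
  have hpow : (d : ℝ) ^ (c - 1) ≤ (1 - 1 / (k : ℝ)) ^ d := by
    refine le_trans ?_ (exp_neg_div_le_one_sub_inv_pow hk1 d)
    rw [Real.rpow_def_of_pos hd0, Real.exp_le_exp]
    have : d / ((k : ℝ) - 1) ≤ d / ((1 + 3 * ε / 4) * d / Real.log d) := by gcongr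
    have e : d / ((1 + 3 * ε / 4) * d / Real.log d) = -(Real.log d * (c - 1)) := by
      rw [hc]; field_simp; ring
    linarith
  have hsplit : (d : ℝ) ^ c = d ^ (ε / 2) * d ^ (c - ε / 2) := by
    rw [← Real.rpow_add hd0]; congr 1; ring
  calc (d : ℝ) ^ (ε / 2) + C ≤ 2 * d ^ (ε / 2) := by linarith
    _ ≤ d ^ c / Real.log d := by
        rw [le_div_iff₀ hlog, hsplit]
        have : (0 : ℝ) ≤ d ^ (ε / 2) := by positivity
        nlinarith
    _ = d / Real.log d * d ^ (c - 1) := by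
        rw [Real.rpow_sub_one hd0.ne']; field_simp
    _ ≤ k * (1 - 1 / (k : ℝ)) ^ d := by gcongr

end DPColoring

theorem theorem1p3 (ε : ℝ) (hε₀ : 0 < ε) (hε₁ : ε < 1 / 2) :
    ∃ n₀ : ℕ, ∀ (V : Type*) [Fintype V] [LinearOrder V] (G : SimpleGraph V) (k : ℕ),
      n₀ ≤ Fintype.card V →
      Real.log (Fintype.card V) ^ (2 / ε) ≤ (DPColoring.degeneracy G : ℝ) →
      (1 + ε) * (DPColoring.degeneracy G : ℝ) / Real.log (DPColoring.degeneracy G) ≤ (k : ℝ) →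
      1 - ε ≤ DPColoring.probDPColorable G k := by
  -- The constant `-log ε` turns the final exponential bound into exactly `ε`.
  obtain ⟨d₀, hd₀⟩ := eventually_atTop.1
    (DPColoring.eventually_le_mul_one_sub_inv_pow hε₀ hε₁ (-Real.log ε))
  have hlarge : ∀ᶠ n : ℕ in atTop, (d₀ : ℝ) ≤ Real.log n ^ (2 / ε) :=
    (((tendsto_rpow_atTop (by positivity)).comp Real.tendsto_log_atTop).comp
      tendsto_natCast_atTop_atTop).eventually_ge_atTop (d₀ : ℝ)
  obtain ⟨n₁, hn₁⟩ := eventually_atTop.1 hlarge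
  -- `n₁` forces `d ≥ d₀`; the `1` gives `log n ≥ 0` and `exp (log n) = n`.
  refine ⟨max n₁ 1, fun V _ _ G k hn hd hk => ?_⟩
  set d := DPColoring.degeneracy G
  set n := Fintype.card V
  have hn1 : (1 : ℝ) ≤ n := by exact_mod_cast (le_max_right _ _).trans hn
  obtain ⟨hk0, hlow⟩ := hd₀ d (by exact_mod_cast (hn₁ n ((le_max_left _ _).trans hn)).trans hd) k hk
  have hlog0 : 0 ≤ Real.log n := Real.log_nonneg hn1
  have hlogn : Real.log n ≤ (d : ℝ) ^ (ε / 2) := by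
    calc Real.log n = (Real.log n ^ (2 / ε)) ^ (ε / 2) := by
          rw [← Real.rpow_mul hlog0, show 2 / ε * (ε / 2) = 1 by field_simp, Real.rpow_one]
      _ ≤ _ := Real.rpow_le_rpow (by positivity) hd (by positivity)
  refine le_trans ?_ (DPColoring.one_sub_le_probDPColorable G hk0
    (DPColoring.isDegenerate_degeneracy G))
  refine sub_le_sub_left ?_ 1
  calc (n : ℝ) * (1 - (1 - 1 / (k : ℝ)) ^ d) ^ k
      ≤ Real.exp (Real.log n) * Real.exp (-(k * (1 - 1 / (k : ℝ)) ^ d)) := by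
        rw [Real.exp_log (by linarith)]
        exact mul_le_mul_of_nonneg_left (DPColoring.one_sub_pow_le_exp hk0) (by linarith)
    _ ≤ Real.exp (Real.log ε) := by
        rw [← Real.exp_add, Real.exp_le_exp]
        linarith
    _ = ε := Real.exp_log hε₀
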